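/- Let $G$ be a finite simple graph without isolated vertices, let $\mathcal A$ be its set of arcs (ordered pairs $(u,v)$ with $uv$ an edge; $v$ is the terminus of $(u,v)$ and $(u,v)^{-1}=(v,u)$). Define $S\in\mathbb C^{\mathcal A\times\mathcal A}$ by $S_{ab}=\delta_{a,b^{-1}}$, $N\in\mathbb C^{V(G)\times\mathcal A}$ by $N_{ua}=\frac{1}{\sqrt{\deg u}}$ if $u$ is the terminus of $a$ and $N_{ua}=0$ otherwise, and let $U=S(2N^*N-I)$ be the time evolution matrix of the Grover walk on $G$. For a vertex $u$ put $\Phi_u=N^*\mathbf e_u$, where $\mathbf e_u$ is the standard unit vector at $u$. The graph $G$ exhibits perfect state transfer at time $\tau$, where $\tau$ is a positive integer, if there are distinct vertices $u,v$ and a complex number $\gamma$ with $|\gamma|=1$ such that $U^\tau\Phi_u=\gamma\Phi_v$; it exhibits perfect state transfer if it does so at some time $\tau$. For positive integers $n,k$ with $n\ge 2k$ and $i\in\{0,\dots,k-1\}$, the generalized Johnson graph $J(n,k,i)$ has as vertices the $k$-subsets of $\{1,\dots,n\}$, two vertices $E,F$ being adjacent if and only if $|E\cap F|=i$. **Theorem.**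 Let $n,k$ be positive integers with $n\ge 2k$ and let $i\in\{0,\dots,k-1\}$. Then $J(n,k,i)$ exhibits perfect state transfer if and only if $(n,k,i)=(2k,k,0)$ or $(n,k,i)=(4,2,1)$. Moreover, $J(4,2,1)$ exhibits perfect state transfer at time $6$. -/

import Mathlib

open scoped Matrix

noncomputable section

namespace GroverWalk

variable {V : Type*} [Fintype V] [DecidableEq V] (G : SimpleGraph V) [DecidableRel G.Adj]

/-- The shift matrix `S`, indexed by the arcs (darts) of `G`: `S a b = 1` if `a = b⁻¹`,
and `0` otherwise. -/
def shiftMatrix : Matrix G.Dart G.Dart ℂ :=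
  Matrix.of fun a b => if a = b.symm then 1 else 0

/-- The boundary matrix `N`: `N u a = 1 / √(deg u)` if `u` is the terminus of the arc `a`,
and `0` otherwise. -/
def boundaryMatrix : Matrix V G.Dart ℂ :=
  Matrix.of fun u a => if u = a.snd then 1 / ((Real.sqrt (G.degree u : ℝ) : ℝ) : ℂ) else 0

/-- The coin matrix `K = 2 N* N - I`. -/
def coinMatrix : Matrix G.Dart G.Dart ℂ :=
  (2 : ℂ) • ((boundaryMatrix G)ᴴ * boundaryMatrix G) - 1

/-- The time evolution matrix `U = S K` of the Grover walk. -/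
def evolutionMatrix : Matrix G.Dart G.Dart ℂ :=
  shiftMatrix G * coinMatrix G

/-- The vertex-type state `Φ_u = N* e_u`. -/
def vertexState (u : V) : G.Dart → ℂ :=
  (boundaryMatrix G)ᴴ *ᵥ Pi.single u 1

/-- Perfect state transfer from the vertex `u` to another vertex `v` at the (positive integer)
time `τ`: `U ^ τ Φ_u = γ Φ_v` for some unimodular complex number `γ`. -/
def HasPSTFromTo (u v : V) (τ : ℕ) : Prop :=
  u ≠ v ∧ 0 < τ ∧
    ∃ γ : ℂ, ‖γ‖ = 1 ∧ (evolutionMatrix G ^ τ) *ᵥ vertexState G u = γ • vertexState G v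

/-- `G` exhibits perfect state transfer at time `τ` (between some two vertices). -/
def HasPSTAt (τ : ℕ) : Prop :=
  ∃ u v : V, HasPSTFromTo G u v τ

/-- `G` exhibits perfect state transfer (between some two vertices, at some time). -/
def HasPST : Prop :=
  ∃ τ : ℕ, HasPSTAt G τ

end GroverWalk

/-- The generalized Johnson graph `J(n,k,i)`: the vertices are the `k`-subsets of an `n`-set, and
two (distinct) vertices `E`, `F` are adjacent if `|E ∩ F| = i`. Distinctness is automatic
for `i < k`. -/
def generalizedJohnson (n k i : ℕ) : SimpleGraph {E : Finset (Fin n) // E.card = k} where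
  Adj E F := E ≠ F ∧ (E.1 ∩ F.1).card = i
  symm := ⟨fun E F h => ⟨h.1.symm, by rw [Finset.inter_comm]; exact h.2⟩⟩
  loopless := ⟨fun _ h => h.1 rfl⟩

instance (n k i : ℕ) : DecidableRel (generalizedJohnson n k i).Adj :=
  fun E F => inferInstanceAs (Decidable (E ≠ F ∧ (E.1 ∩ F.1).card = i))

end

/-! ### Grover walks on regular graphs and Chebyshev polynomials. -/

namespace GroverWalk

variable {V : Type*} [Fintype V] [DecidableEq V] (G : SimpleGraph V) [DecidableRel G.Adj]

/-! On a `d`-regular graph `N S N* = A / d`, and `N U^t N*` satisfies the Chebyshev recurrence in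
this matrix. Perfect state transfer from `u` to `v` at time `τ` thus gives `T_τ(μ) f(u) = γ f(v)`
for each eigenvector `f` of `A / d`; the constant vector forces `γ = 1`
(`HasPSTFromTo.chebyshev_eval_mul_eq`).

For `J(n,k,i)`, membership of a single point yields eigenvectors (`sum_sgn_add_const`). Points of `u
\ v` and `v \ u` then force `n = 2k` and `T_τ(μ₁) = -1`, where `μ₁ = (2i - k)/k`. Pairs of points
yield a second eigenvalue `μ₂` (`sum_sgn_mul_sgn_add_const`), with `T_τ(μ₂) = 1`. Both are rational
cosines of rational multiples of `π`, so Niven's theorem confines them to `0, ±1/2, ±1`; as `μ₂` is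
determined by `μ₁` and `k`, only `i = 0` or `(k, i) = (2, 1)` survives.

Conversely, `J(2k,k,0)` is a perfect matching, and on the octahedron `J(4,2,1)` the operator `U^6`
acts by signs on the lifts of three eigenvectors spanning the two antipodal vertex states. -/

lemma shiftMatrix_mul_self : shiftMatrix G * shiftMatrix G = 1 := by
  ext a b
  simp only [Matrix.mul_apply, shiftMatrix, Matrix.of_apply, Matrix.one_apply, mul_ite, mul_one,
    mul_zero, Finset.sum_ite_eq', Finset.mem_univ, if_true,
    SimpleGraph.Dart.symm_symm]

lemma card_darts_snd_eq (v : V) :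
    (Finset.univ.filter fun a : G.Dart => v = a.snd).card = G.degree v := by
  rw [← G.dart_fst_fiber_card_eq_degree v]
  refine Finset.card_bij' (fun a _ => a.symm) (fun a _ => a.symm) ?_ ?_ ?_ ?_ <;>
    simp [eq_comm]

variable {G}

lemma boundaryMatrix_mul_conjTranspose (hG : ∀ v, 0 < G.degree v) :
    boundaryMatrix G * (boundaryMatrix G)ᴴ = 1 := by
  ext u v
  simp only [Matrix.mul_apply, Matrix.conjTranspose_apply, boundaryMatrix, Matrix.of_apply,
    Matrix.one_apply]
  split_ifs with h
  · subst h
    have h0 : ((G.degree u : ℝ) : ℂ) ≠ 0 := by exact_mod_cast (hG u).ne'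
    have h1 : ∀ a : G.Dart,
        (if u = a.snd then 1 / ((Real.sqrt (G.degree u : ℝ) : ℝ) : ℂ) else 0) *
          star (if u = a.snd then 1 / ((Real.sqrt (G.degree u : ℝ) : ℝ) : ℂ) else 0) =
        if u = a.snd then 1 / ((G.degree u : ℝ) : ℂ) else 0 := by
      intro a
      split_ifs
      · rw [Complex.star_def, map_div₀, Complex.conj_ofReal, map_one, div_mul_div_comm, one_mul,
          ← Complex.ofReal_mul, Real.mul_self_sqrt (Nat.cast_nonneg _)]
      · simp
    rw [Finset.sum_congr rfl fun a _ => h1 a, ← Finset.sum_filter, Finset.sum_const,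
      card_darts_snd_eq, nsmul_eq_mul, ← Complex.ofReal_natCast, mul_one_div_cancel h0]
  · refine Finset.sum_eq_zero fun a _ => ?_
    by_cases hu : u = a.snd
    · rw [if_neg (show ¬ v = a.snd from fun hv => h (hu.trans hv.symm))]
      simp
    · rw [if_neg hu, zero_mul]

/-- In the entry at `(u, v)` only the arc from `u` to `v` contributes, with weight `(1 / √d)²`. -/
lemma boundaryMatrix_mul_shiftMatrix_mul_conjTranspose {d : ℕ} (hG : G.IsRegularOfDegree d) :
    boundaryMatrix G * shiftMatrix G * (boundaryMatrix G)ᴴ =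
      ((d : ℂ)⁻¹) • G.adjMatrix ℂ := by
  have hS : ∀ u a, (boundaryMatrix G * shiftMatrix G) u a =
      if u = a.fst then 1 / ((Real.sqrt (d : ℝ) : ℝ) : ℂ) else 0 := by
    intro u a
    simp [Matrix.mul_apply, boundaryMatrix, shiftMatrix, hG.degree_eq u]
  ext u v
  rw [Matrix.mul_apply]
  simp only [hS, Matrix.conjTranspose_apply]
  simp only [boundaryMatrix, Matrix.of_apply, hG.degree_eq, Matrix.smul_apply, SimpleGraph.adjMatrix_apply, smul_eq_mul]
  split_ifs with h
  · have hc : ∀ a : G.Dart, a ≠ ⟨(u, v), h⟩ → ¬ (u = a.fst ∧ v = a.snd) := by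
      rintro a ha ⟨rfl, rfl⟩
      exact ha rfl
    rw [Finset.sum_eq_single (⟨(u, v), h⟩ : G.Dart)]
    · simp only [if_true]
      rw [Complex.star_def, map_div₀, Complex.conj_ofReal, map_one, div_mul_div_comm, one_mul,
          ← Complex.ofReal_mul, Real.mul_self_sqrt (Nat.cast_nonneg _)]
      simp
    · intro a _ ha
      have := hc a ha
      by_cases hu : u = a.fst
      · rw [if_neg (show ¬ v = a.snd from fun hv => this ⟨hu, hv⟩)]
        simp
      · rw [if_neg hu, zero_mul]
    · simp
  · rw [mul_zero]
    refine Finset.sum_eq_zero fun a _ => ?_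
    by_cases hu : u = a.fst
    · rw [if_neg (show ¬ v = a.snd from fun hv => h (by rw [hu, hv]; exact a.adj))]
      simp
    · rw [if_neg hu, zero_mul]

lemma boundaryMatrix_mul_coinMatrix (hG : ∀ v, 0 < G.degree v) :
    boundaryMatrix G * coinMatrix G = boundaryMatrix G := by
  rw [coinMatrix, Matrix.mul_sub, Matrix.mul_smul, ← Matrix.mul_assoc,
    boundaryMatrix_mul_conjTranspose hG, Matrix.one_mul, Matrix.mul_one, two_smul, add_sub_cancel_right]

/-- Since `N N* = 1`, the coin is the reflection fixing the range of `N*` pointwise. -/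
lemma coinMatrix_mul_conjTranspose (hG : ∀ v, 0 < G.degree v) :
    coinMatrix G * (boundaryMatrix G)ᴴ = (boundaryMatrix G)ᴴ := by
  rw [coinMatrix, Matrix.sub_mul, Matrix.smul_mul, Matrix.mul_assoc,
    boundaryMatrix_mul_conjTranspose hG, Matrix.one_mul, Matrix.mul_one, two_smul, add_sub_cancel_right]

lemma shiftMatrix_mul_evolutionMatrix : shiftMatrix G * evolutionMatrix G = coinMatrix G := by
  rw [evolutionMatrix, ← mul_assoc, shiftMatrix_mul_self, one_mul]

/-- `N U² = 2 P N U - N`, where `P = N S N*` is the discriminant of the walk. -/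
lemma boundaryMatrix_mul_evolutionMatrix_mul_self (hG : ∀ v, 0 < G.degree v) :
    boundaryMatrix G * (evolutionMatrix G * evolutionMatrix G) =
      (2 : ℂ) • (boundaryMatrix G * shiftMatrix G * (boundaryMatrix G)ᴴ *
        (boundaryMatrix G * evolutionMatrix G)) - boundaryMatrix G := by
  conv_lhs =>
    rw [evolutionMatrix, Matrix.mul_assoc (shiftMatrix G), ← evolutionMatrix, coinMatrix,
      Matrix.sub_mul, Matrix.mul_sub, Matrix.one_mul, shiftMatrix_mul_evolutionMatrix,
      Matrix.mul_sub, boundaryMatrix_mul_coinMatrix hG]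
  simp only [Matrix.smul_mul, Matrix.mul_smul, Matrix.mul_assoc]

/-- The matrix elements of the powers of `U` between vertex states and an eigenvector of the
discriminant are Chebyshev polynomials of the first kind in the eigenvalue. -/
lemma dotProduct_boundaryMatrix_evolutionMatrix_pow {d : ℕ} (hd : 0 < d)
    (hG : G.IsRegularOfDegree d) {f : V → ℂ} {μ : ℂ}
    (hf : G.adjMatrix ℂ *ᵥ f = (d * μ) • f) (u : V) (t : ℕ) :
    f ⬝ᵥ (boundaryMatrix G * evolutionMatrix G ^ t) *ᵥ vertexState G u =
      (Polynomial.Chebyshev.T ℂ t).eval μ * f u := by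
  have hpos : ∀ v, 0 < G.degree v := fun v => by rwa [hG.degree_eq]
  have hd' : (d : ℂ) ≠ 0 := by exact_mod_cast hd.ne'
  have hP : f ᵥ* (boundaryMatrix G * shiftMatrix G * (boundaryMatrix G)ᴴ) = μ • f := by
    rw [boundaryMatrix_mul_shiftMatrix_mul_conjTranspose hG, Matrix.vecMul_smul,
      ← Matrix.mulVec_transpose, SimpleGraph.transpose_adjMatrix, hf, smul_smul,
      inv_mul_cancel_left₀ hd']
  induction t using Nat.twoStepInduction with
  | zero =>
    rw [pow_zero, Matrix.mul_one, vertexState, Matrix.mulVec_mulVec,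
      boundaryMatrix_mul_conjTranspose hpos, Matrix.one_mulVec]
    simp
  | one =>
    rw [pow_one, vertexState, Matrix.mulVec_mulVec, Matrix.mul_assoc, evolutionMatrix,
      Matrix.mul_assoc, coinMatrix_mul_conjTranspose hpos, ← Matrix.mul_assoc,
      Matrix.dotProduct_mulVec, hP]
    simp
  | more t h0 h1 =>
    have : boundaryMatrix G * evolutionMatrix G ^ (t + 2) =
        (2 : ℂ) • (boundaryMatrix G * shiftMatrix G * (boundaryMatrix G)ᴴ *
          (boundaryMatrix G * evolutionMatrix G ^ (t + 1))) -
          boundaryMatrix G * evolutionMatrix G ^ t := by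
      rw [pow_add, pow_two, (Commute.pow_left (Commute.mul_right rfl rfl) t).eq,
        ← Matrix.mul_assoc, boundaryMatrix_mul_evolutionMatrix_mul_self hpos, Matrix.sub_mul,
        Matrix.smul_mul, pow_succ']
      simp only [Matrix.mul_assoc]
    rw [this, Matrix.sub_mulVec, Matrix.smul_mulVec, dotProduct_sub, dotProduct_smul,
      ← Matrix.mulVec_mulVec, Matrix.dotProduct_mulVec f, hP, smul_dotProduct, h0, h1]
    push_cast
    rw [Polynomial.Chebyshev.T_add_two]
    simp only [Polynomial.eval_sub, Polynomial.eval_mul, Polynomial.eval_X, Polynomial.eval_ofNat,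
      smul_eq_mul]
    ring

/-- Perfect state transfer from `u` to `v` at time `τ` in a regular graph forces every eigenvector
`f` of the transition matrix, with eigenvalue `μ`, to satisfy `T_τ(μ) f(u) = f(v)`. -/
theorem HasPSTFromTo.chebyshev_eval_mul_eq {d : ℕ} (hd : 0 < d) (hG : G.IsRegularOfDegree d)
    {u v : V} {τ : ℕ} (h : HasPSTFromTo G u v τ) {f : V → ℝ} {μ : ℝ}
    (hf : ∀ w, ∑ x ∈ G.neighborFinset w, f x = d * μ * f w) :
    (Polynomial.Chebyshev.T ℝ τ).eval μ * f u = f v := by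
  obtain ⟨-, -, γ, -, hγ⟩ := h
  have hpos : ∀ v, 0 < G.degree v := fun v => by rwa [hG.degree_eq]
  have key : ∀ (g : V → ℝ) (ν : ℝ), (∀ w, ∑ x ∈ G.neighborFinset w, g x = d * ν * g w) →
      (((Polynomial.Chebyshev.T ℝ τ).eval ν * g u : ℝ) : ℂ) = γ * (g v : ℂ) := by
    intro g ν hg
    have hg' : G.adjMatrix ℂ *ᵥ (fun x => (g x : ℂ)) = ((d : ℂ) * (ν : ℂ)) • fun x => (g x : ℂ) := by
      ext w
      rw [SimpleGraph.adjMatrix_mulVec_apply, Pi.smul_apply, smul_eq_mul]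
      exact_mod_cast hg w
    have := dotProduct_boundaryMatrix_evolutionMatrix_pow hd hG hg' u τ
    rw [← Matrix.mulVec_mulVec, hγ, Matrix.mulVec_smul, vertexState, Matrix.mulVec_mulVec,
      boundaryMatrix_mul_conjTranspose hpos, Matrix.one_mulVec, dotProduct_smul] at this
    rw [Complex.ofReal_mul, Polynomial.Chebyshev.complex_ofReal_eval_T, ← this]
    simp
  -- The constant eigenvector has `μ = 1`, and `T_τ(1) = 1`, so the phase is trivial.
  have h1 := key (fun _ => 1) 1 (fun w => by simp [hG.degree_eq])
  have hγ1 : γ = 1 := by simpa using h1.symm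
  have h2 := key f μ hf
  rw [hγ1, one_mul] at h2
  exact_mod_cast h2

/-- If a Chebyshev polynomial of positive degree takes a value of modulus one at a rational
number `μ`, then `μ` is one of `0, ±1/2, ±1`. -/
lemma mem_of_abs_chebyshev_eval_eq_one {τ : ℕ} (hτ : τ ≠ 0) {μ : ℝ} (hμ : ∃ q : ℚ, μ = q)
    (h : |(Polynomial.Chebyshev.T ℝ τ).eval μ| = 1) :
    μ ∈ ({-1, -1 / 2, 0, 1 / 2, 1} : Set ℝ) := by
  -- Here `μ = cos (m π / τ)`, which is what Niven's theorem needs.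
  obtain ⟨m, -, rfl⟩ := (Polynomial.Chebyshev.abs_eval_T_real_eq_one_iff hτ μ).1 h
  exact niven ⟨m / τ, by push_cast; ring⟩ hμ

end GroverWalk

/-! ### Regularity and two eigenvalues of the generalized Johnson graphs. -/

namespace generalizedJohnson

variable {n k i : ℕ}

lemma mem_neighborFinset (hik : i < k) {E F : {E : Finset (Fin n) // E.card = k}} :
    F ∈ (generalizedJohnson n k i).neighborFinset E ↔ (E.1 ∩ F.1).card = i := by
  rw [SimpleGraph.mem_neighborFinset]
  refine ⟨fun h => h.2, fun h => ⟨?_, h⟩⟩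
  rintro rfl
  rw [Finset.inter_self, E.2] at h
  omega

/-- A `k`-subset `F` meeting `E` in `i` points is the union of an `i`-subset of `E` and a
`(k - i)`-subset of the complement of `E`. -/
theorem isRegularOfDegree (hik : i < k) :
    (generalizedJohnson n k i).IsRegularOfDegree (k.choose i * (n - k).choose (k - i)) := by
  intro E
  rw [← SimpleGraph.card_neighborFinset_eq_degree]
  have hcard : ((E.1.powersetCard i) ×ˢ (E.1ᶜ.powersetCard (k - i))).card =
      k.choose i * (n - k).choose (k - i) := by
    rw [Finset.card_product, Finset.card_powersetCard, Finset.card_powersetCard,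
      Finset.card_compl, E.2, Fintype.card_fin]
  rw [← hcard]
  refine Finset.card_bij (fun F _ => (E.1 ∩ F.1, F.1 \ E.1)) ?_ ?_ ?_
  · intro F hF
    rw [mem_neighborFinset hik] at hF
    have := Finset.card_sdiff_add_card_inter F.1 E.1
    rw [Finset.inter_comm, hF, F.2] at this
    simp only [Finset.mem_product, Finset.mem_powersetCard]
    refine ⟨⟨Finset.inter_subset_left, hF⟩, fun x hx => ?_, by omega⟩
    rw [Finset.mem_compl]
    exact (Finset.mem_sdiff.1 hx).2
  · intro F _ F' _ h
    obtain ⟨h1, h2⟩ := Prod.mk.inj h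
    apply Subtype.ext
    rw [← Finset.sdiff_union_inter F.1 E.1, ← Finset.sdiff_union_inter F'.1 E.1, h2,
      Finset.inter_comm, h1, Finset.inter_comm]
  · rintro ⟨X, Y⟩ h
    simp only [Finset.mem_product, Finset.mem_powersetCard] at h
    obtain ⟨⟨hX, hXi⟩, hY, hYi⟩ := h
    have hYE : Disjoint E.1 Y := by
      rw [Finset.disjoint_left]
      exact fun x hx hy => Finset.mem_compl.1 (hY hy) hx
    have hXY : Disjoint X Y := hYE.mono_left hX
    have h1 : E.1 ∩ (X ∪ Y) = X := by
      rw [Finset.inter_union_distrib_left, Finset.inter_eq_right.2 hX,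
        Finset.disjoint_iff_inter_eq_empty.1 hYE, Finset.union_empty]
    have h2 : (X ∪ Y) \ E.1 = Y := by
      rw [Finset.union_sdiff_distrib, Finset.sdiff_eq_empty_iff_subset.2 hX,
        Finset.sdiff_eq_self_of_disjoint hYE.symm, Finset.empty_union]
    refine ⟨⟨X ∪ Y, by rw [Finset.card_union_of_disjoint hXY]; omega⟩, ?_, Prod.ext h1 h2⟩
    rw [mem_neighborFinset hik]
    change (E.1 ∩ (X ∪ Y)).card = i
    rw [h1, hXi]

lemma degree_pos (hn : 2 * k ≤ n) (hik : i < k) :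
    0 < k.choose i * (n - k).choose (k - i) :=
  Nat.mul_pos (Nat.choose_pos hik.le) (Nat.choose_pos (by omega))

/-- The action of a permutation of the ground set on the vertices. -/
def permVertex (σ : Equiv.Perm (Fin n)) :
    {E : Finset (Fin n) // E.card = k} ≃ {E : Finset (Fin n) // E.card = k} :=
  σ.finsetCongr.subtypeEquiv fun E => by simp

/-- The `±1`-valued indicator of a point belonging to a vertex. -/
noncomputable def sgn (a : Fin n) (E : {E : Finset (Fin n) // E.card = k}) : ℝ :=
  if a ∈ E.1 then 1 else -1

lemma sgn_of_mem {a : Fin n} {E : {E : Finset (Fin n) // E.card = k}} (h : a ∈ E.1) :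
    sgn a E = 1 := if_pos h

lemma sgn_of_notMem {a : Fin n} {E : {E : Finset (Fin n) // E.card = k}} (h : a ∉ E.1) :
    sgn a E = -1 := if_neg h

lemma sgn_mul_self (a : Fin n) (E : {E : Finset (Fin n) // E.card = k}) :
    sgn a E * sgn a E = 1 := by
  unfold sgn; split_ifs <;> norm_num

lemma sgn_permVertex (σ : Equiv.Perm (Fin n)) (a : Fin n)
    (E : {E : Finset (Fin n) // E.card = k}) : sgn a (permVertex σ E) = sgn (σ.symm a) E := by
  simp [sgn, permVertex, Finset.mem_map_equiv]

lemma sum_sgn (B : Finset (Fin n)) (F : {E : Finset (Fin n) // E.card = k}) :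
    ∑ b ∈ B, sgn b F = 2 * ((B ∩ F.1).card : ℝ) - B.card := by
  have : ∀ b ∈ B, sgn b F = 2 * (if b ∈ F.1 then (1 : ℝ) else 0) - 1 := fun b _ => by
    unfold sgn; split_ifs <;> norm_num
  rw [Finset.sum_congr rfl this, Finset.sum_sub_distrib, ← Finset.mul_sum,
    ← Finset.sum_filter, Finset.filter_mem_eq_inter]
  simp

/-- Permutations preserve intersection sizes, so one that fixes `E` permutes the neighbours of `E`.
-/
lemma sum_neighborFinset_permVertex (hik : i < k) {σ : Equiv.Perm (Fin n)}
    {E : {E : Finset (Fin n) // E.card = k}} (hσ : permVertex σ E = E)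
    (h : {E : Finset (Fin n) // E.card = k} → ℝ) :
    ∑ F ∈ (generalizedJohnson n k i).neighborFinset E, h (permVertex σ F) =
      ∑ F ∈ (generalizedJohnson n k i).neighborFinset E, h F := by
  refine Finset.sum_equiv (permVertex σ) (fun F => ?_) (fun _ _ => rfl)
  rw [mem_neighborFinset hik, mem_neighborFinset hik]
  conv_rhs => rw [← hσ]
  change _ ↔ (E.1.map σ.toEmbedding ∩ F.1.map σ.toEmbedding).card = i
  rw [← Finset.map_inter, Finset.card_map]

/-- Averaging over a set `B` of points on which the stabilizer of `E` acts transitively. -/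
lemma card_mul_sum_neighborFinset (hik : i < k) {E : {E : Finset (Fin n) // E.card = k}}
    {B : Finset (Fin n)} (hB : B ⊆ E.1 ∨ B ⊆ E.1ᶜ)
    {h : {E : Finset (Fin n) // E.card = k} → ℝ}
    (hh : ∀ b ∈ B, ∀ c ∈ B, ∀ F, h (permVertex (Equiv.swap b c) F) = h F) {b : Fin n}
    (hb : b ∈ B) :
    B.card * ∑ F ∈ (generalizedJohnson n k i).neighborFinset E, h F * sgn b F =
      ∑ F ∈ (generalizedJohnson n k i).neighborFinset E, h F * ∑ c ∈ B, sgn c F := by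
  have hconst : ∀ c ∈ B,
      ∑ F ∈ (generalizedJohnson n k i).neighborFinset E, h F * sgn c F =
        ∑ F ∈ (generalizedJohnson n k i).neighborFinset E, h F * sgn b F := by
    intro c hc
    -- Both points lie on the same side of `E`, so swapping them fixes `E`.
    have hfix : permVertex (Equiv.swap b c) E = E := by
      apply Subtype.ext
      change E.1.map (Equiv.swap b c).toEmbedding = E.1
      ext x
      rw [Finset.mem_map_equiv, Equiv.symm_swap]
      have hbc : b ∈ E.1 ↔ c ∈ E.1 := by
        rcases hB with hB | hB
        · exact iff_of_true (hB hb) (hB hc)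
        · exact iff_of_false (Finset.mem_compl.1 (hB hb)) (Finset.mem_compl.1 (hB hc))
      rcases eq_or_ne x b with rfl | hxb
      · rw [Equiv.swap_apply_left, hbc]
      rcases eq_or_ne x c with rfl | hxc
      · rw [Equiv.swap_apply_right, hbc]
      · rw [Equiv.swap_apply_of_ne_of_ne hxb hxc]
    rw [← sum_neighborFinset_permVertex hik hfix]
    refine Finset.sum_congr rfl fun F _ => ?_
    rw [hh b hb c hc, sgn_permVertex, Equiv.symm_swap, Equiv.swap_apply_right]
  rw [← nsmul_eq_mul, ← Finset.sum_const, ← Finset.sum_congr rfl hconst, Finset.sum_comm]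
  refine Finset.sum_congr rfl fun F _ => ?_
  rw [← Finset.mul_sum]

/-- This sum does not depend on the neighbour `F`, and likewise over the complement; averaging over
either side of `E` therefore gives closed formulas. -/
lemma sum_sgn_of_mem_neighborFinset (hik : i < k) {E F : {E : Finset (Fin n) // E.card = k}}
    (h : F ∈ (generalizedJohnson n k i).neighborFinset E) :
    ∑ c ∈ E.1, sgn c F = 2 * i - k := by
  rw [sum_sgn, (mem_neighborFinset hik).1 h, E.2]

lemma sum_sgn_compl_of_mem_neighborFinset (hik : i < k) (hkn : k ≤ n)
    {E F : {E : Finset (Fin n) // E.card = k}}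
    (h : F ∈ (generalizedJohnson n k i).neighborFinset E) :
    ∑ c ∈ E.1ᶜ, sgn c F = 2 * (k - i) - (n - k) := by
  rw [mem_neighborFinset hik] at h
  have := Finset.card_sdiff_add_card_inter F.1 E.1
  rw [Finset.inter_comm, h, F.2, Finset.sdiff_eq_inter_compl, Finset.inter_comm] at this
  rw [sum_sgn, Finset.card_compl, E.2, Fintype.card_fin, Nat.cast_sub hkn,
    show ((E.1ᶜ ∩ F.1).card : ℝ) = k - i from eq_sub_of_add_eq (by exact_mod_cast this)]

lemma sum_const_neighborFinset (hik : i < k) (E : {E : Finset (Fin n) // E.card = k}) (c : ℝ) :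
    ∑ _F ∈ (generalizedJohnson n k i).neighborFinset E, c =
      (k.choose i * (n - k).choose (k - i) : ℕ) * c := by
  rw [Finset.sum_const, SimpleGraph.card_neighborFinset_eq_degree,
    (isRegularOfDegree hik).degree_eq, nsmul_eq_mul]

section Averages

variable {E : {E : Finset (Fin n) // E.card = k}} {B C : Finset (Fin n)} {s t : ℝ} {a b : Fin n}

lemma card_mul_sum_sgn (hik : i < k) (hB : B ⊆ E.1 ∨ B ⊆ E.1ᶜ)
    (hs : ∀ F ∈ (generalizedJohnson n k i).neighborFinset E, ∑ c ∈ B, sgn c F = s)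
    (ha : a ∈ B) :
    B.card * ∑ F ∈ (generalizedJohnson n k i).neighborFinset E, sgn a F =
      (k.choose i * (n - k).choose (k - i) : ℕ) * s := by
  have := card_mul_sum_neighborFinset hik (E := E) (h := fun _ => 1) hB
    (fun _ _ _ _ _ => rfl) ha
  simp only [one_mul] at this
  rw [this, Finset.sum_congr rfl hs, sum_const_neighborFinset hik]

/-- Averages twice: over `b` in `B.erase a` with `sgn a` as weight, then over `a` in `B`. -/
lemma card_mul_card_sub_one_mul_sum_sgn_mul_sgn (hik : i < k) (hB : B ⊆ E.1 ∨ B ⊆ E.1ᶜ)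
    (hs : ∀ F ∈ (generalizedJohnson n k i).neighborFinset E, ∑ c ∈ B, sgn c F = s)
    (ha : a ∈ B) (hb : b ∈ B) (hab : a ≠ b) :
    B.card * ((B.card - 1) *
        ∑ F ∈ (generalizedJohnson n k i).neighborFinset E, sgn a F * sgn b F) =
      (k.choose i * (n - k).choose (k - i) : ℕ) * (s ^ 2 - B.card) := by
  have hsub : B.erase a ⊆ B := Finset.erase_subset _ _
  have h1 := card_mul_sum_neighborFinset hik (E := E) (B := B.erase a) (h := sgn a)
    (hB.imp hsub.trans hsub.trans) (fun x hx y hy F => by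
      rw [sgn_permVertex, Equiv.symm_swap, Equiv.swap_apply_of_ne_of_ne
        (Finset.ne_of_mem_erase hx).symm (Finset.ne_of_mem_erase hy).symm])
    (Finset.mem_erase.2 ⟨hab.symm, hb⟩)
  rw [Finset.card_erase_of_mem ha, Nat.cast_sub (Finset.card_pos.2 ⟨a, ha⟩), Nat.cast_one] at h1
  -- Removing `a` from the sum costs `sgn a F * sgn a F = 1`; this is the source of the `- B.card`
  -- in the conclusion.
  have h2 : ∀ F ∈ (generalizedJohnson n k i).neighborFinset E,
      sgn a F * ∑ c ∈ B.erase a, sgn c F = sgn a F * s - 1 := by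
    intro F hF
    rw [Finset.sum_erase_eq_sub ha, hs F hF, mul_sub, sgn_mul_self]
  rw [h1, Finset.sum_congr rfl h2, Finset.sum_sub_distrib, ← Finset.sum_mul, mul_sub,
    ← mul_assoc, card_mul_sum_sgn hik hB hs ha, sum_const_neighborFinset hik]
  ring

lemma card_mul_card_mul_sum_sgn_mul_sgn (hik : i < k) (hB : B ⊆ E.1 ∨ B ⊆ E.1ᶜ)
    (hC : C ⊆ E.1 ∨ C ⊆ E.1ᶜ)
    (hs : ∀ F ∈ (generalizedJohnson n k i).neighborFinset E, ∑ c ∈ B, sgn c F = s)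
    (ht : ∀ F ∈ (generalizedJohnson n k i).neighborFinset E, ∑ c ∈ C, sgn c F = t)
    (ha : a ∈ B) (haC : a ∉ C) (hb : b ∈ C) :
    B.card * (C.card *
        ∑ F ∈ (generalizedJohnson n k i).neighborFinset E, sgn a F * sgn b F) =
      (k.choose i * (n - k).choose (k - i) : ℕ) * (s * t) := by
  have h1 := card_mul_sum_neighborFinset hik (E := E) (h := sgn a) hC
    (fun x hx y hy F => by
      rw [sgn_permVertex, Equiv.symm_swap, Equiv.swap_apply_of_ne_of_ne
        (ne_of_mem_of_not_mem hx haC).symm (ne_of_mem_of_not_mem hy haC).symm]) hb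
  have h2 : ∀ F ∈ (generalizedJohnson n k i).neighborFinset E,
      sgn a F * ∑ c ∈ C, sgn c F = sgn a F * t := fun F hF => by rw [ht F hF]
  rw [h1, Finset.sum_congr rfl h2, ← Finset.sum_mul, ← mul_assoc,
    card_mul_sum_sgn hik hB hs ha]
  ring

end Averages

/-- The first nontrivial eigenvalue of the transition matrix, with its eigenvectors. -/
theorem sum_sgn_add_const (hn : 2 * k ≤ n) (hik : i < k) (a : Fin n)
    (E : {E : Finset (Fin n) // E.card = k}) :
    ∑ F ∈ (generalizedJohnson n k i).neighborFinset E, (sgn a F + (n - 2 * k) / n) =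
      (k.choose i * (n - k).choose (k - i) : ℕ) * ((i : ℝ) / k - (k - i) / (n - k)) *
        (sgn a E + (n - 2 * k) / n) := by
  have hk0 : (k : ℝ) ≠ 0 := by
    have : k ≠ 0 := by omega
    exact_mod_cast this
  have hn0 : (n : ℝ) ≠ 0 := by
    have : n ≠ 0 := by omega
    exact_mod_cast this
  have hnk : (n : ℝ) - k ≠ 0 := by
    have : k < n := by omega
    exact sub_ne_zero.2 (by exact_mod_cast this.ne')
  rw [Finset.sum_add_distrib, sum_const_neighborFinset hik]
  by_cases ha : a ∈ E.1
  · have h := card_mul_sum_sgn hik (Or.inl subset_rfl)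
      (fun F hF => sum_sgn_of_mem_neighborFinset hik hF) ha
    rw [E.2] at h
    rw [eq_div_of_mul_eq hk0 ((mul_comm _ _).trans h), sgn_of_mem ha]
    field_simp
    ring
  · have h := card_mul_sum_sgn hik (Or.inr subset_rfl)
      (fun F hF => sum_sgn_compl_of_mem_neighborFinset hik (by omega) hF) (Finset.mem_compl.2 ha)
    rw [Finset.card_compl, E.2, Fintype.card_fin, Nat.cast_sub (by omega)] at h
    rw [eq_div_of_mul_eq hnk ((mul_comm _ _).trans h), sgn_of_notMem ha]
    field_simp
    ring

/-- The second nontrivial eigenvalue of the transition matrix for `n = 2k`, with its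
eigenvectors. -/
theorem sum_sgn_mul_sgn_add_const (hk : 2 ≤ k) (hik : i < k) {a b : Fin (2 * k)} (hab : a ≠ b)
    (E : {E : Finset (Fin (2 * k)) // E.card = k}) :
    ∑ F ∈ (generalizedJohnson (2 * k) k i).neighborFinset E,
        (sgn a F * sgn b F + 1 / (2 * k - 1)) =
      (k.choose i * (2 * k - k).choose (k - i) : ℕ) *
        (((2 * k - 1) * ((2 * i - k) / k) ^ 2 - 1) / (2 * (k - 1))) *
        (sgn a E * sgn b E + 1 / (2 * k - 1)) := by
  have hk2 : (2 : ℝ) ≤ k := by exact_mod_cast hk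
  have hk0 : (k : ℝ) ≠ 0 := by linarith
  have hk1 : (k : ℝ) - 1 ≠ 0 := by linarith
  have hk3 : 2 * (k : ℝ) - 1 ≠ 0 := by linarith
  have hs := fun F hF => sum_sgn_of_mem_neighborFinset (n := 2 * k) (E := E) (F := F) hik hF
  have ht : ∀ F ∈ (generalizedJohnson (2 * k) k i).neighborFinset E,
      ∑ c ∈ E.1ᶜ, sgn c F = -(2 * i - k) := fun F hF => by
    rw [sum_sgn_compl_of_mem_neighborFinset hik (by omega) hF]
    push_cast
    ring
  have hc : (E.1ᶜ).card = k := by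
    rw [Finset.card_compl, E.2, Fintype.card_fin]
    omega
  rw [Finset.sum_add_distrib, sum_const_neighborFinset hik]
  have hdiv : ∀ {x y z w : ℝ}, x ≠ 0 → y ≠ 0 → x * (y * z) = w → z = w / (x * y) :=
    fun hx hy h => eq_div_of_mul_eq (mul_ne_zero hx hy) (by rw [← h]; ring)
  by_cases ha : a ∈ E.1 <;> by_cases hb : b ∈ E.1
  · have h := card_mul_card_sub_one_mul_sum_sgn_mul_sgn hik (Or.inl subset_rfl) hs ha hb hab
    rw [E.2] at h
    rw [hdiv hk0 hk1 h, sgn_of_mem ha, sgn_of_mem hb]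
    field_simp
    ring
  · have h := card_mul_card_mul_sum_sgn_mul_sgn hik (Or.inl subset_rfl) (Or.inr subset_rfl) hs ht
      ha (by simpa using ha) (Finset.mem_compl.2 hb)
    rw [E.2, hc] at h
    rw [hdiv hk0 hk0 h, sgn_of_mem ha, sgn_of_notMem hb]
    field_simp
    ring
  · have h := card_mul_card_mul_sum_sgn_mul_sgn hik (Or.inr subset_rfl) (Or.inl subset_rfl) ht hs
      (Finset.mem_compl.2 ha) ha hb
    rw [E.2, hc] at h
    rw [hdiv hk0 hk0 h, sgn_of_notMem ha, sgn_of_mem hb]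
    field_simp
    ring
  · have h := card_mul_card_sub_one_mul_sum_sgn_mul_sgn hik (Or.inr subset_rfl) ht
      (Finset.mem_compl.2 ha) (Finset.mem_compl.2 hb) hab
    rw [hc] at h
    rw [hdiv hk0 hk1 h, sgn_of_notMem ha, sgn_of_notMem hb]
    field_simp
    ring

end generalizedJohnson

/-! ### The walk on lifts of eigenvectors. -/

namespace GroverWalk

variable {V : Type*} [Fintype V] [DecidableEq V] {G : SimpleGraph V} [DecidableRel G.Adj]

lemma shiftMatrix_mulVec_apply (x : G.Dart → ℂ) (a : G.Dart) :
    (shiftMatrix G *ᵥ x) a = x a.symm := by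
  have h : ∀ b : G.Dart, a = b.symm ↔ b = a.symm := fun b =>
    ⟨fun h => by rw [h, SimpleGraph.Dart.symm_symm],
      fun h => by rw [h, SimpleGraph.Dart.symm_symm]⟩
  simp [Matrix.mulVec, dotProduct, shiftMatrix, h]

lemma conjTranspose_boundaryMatrix_mulVec_apply (g : V → ℂ) (a : G.Dart) :
    ((boundaryMatrix G)ᴴ *ᵥ g) a = g a.snd / (Real.sqrt (G.degree a.snd : ℝ) : ℝ) := by
  simp [Matrix.mulVec, dotProduct, boundaryMatrix, apply_ite, div_eq_inv_mul]

lemma evolutionMatrix_mulVec_conjTranspose_mulVec (hG : ∀ v, 0 < G.degree v) (g : V → ℂ) :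
    evolutionMatrix G *ᵥ ((boundaryMatrix G)ᴴ *ᵥ g) =
      shiftMatrix G *ᵥ ((boundaryMatrix G)ᴴ *ᵥ g) := by
  rw [evolutionMatrix, Matrix.mulVec_mulVec, Matrix.mul_assoc, coinMatrix_mul_conjTranspose hG,
    Matrix.mulVec_mulVec]

/-- With `X = N* g` and `Y = S X`, the walk sends `X` to `Y` and `Y` to `2μY - X`. On their span `U²
- 2μU + 1 = 0`, so for `μ = cos θ` the walk behaves like a rotation by `θ`. -/
lemma evolutionMatrix_mulVec_shiftMatrix_mulVec {d : ℕ} (hd : 0 < d)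
    (hG : G.IsRegularOfDegree d) {g : V → ℂ} {μ : ℂ}
    (hg : G.adjMatrix ℂ *ᵥ g = (d * μ) • g) :
    evolutionMatrix G *ᵥ (shiftMatrix G *ᵥ ((boundaryMatrix G)ᴴ *ᵥ g)) =
      (2 * μ) • (shiftMatrix G *ᵥ ((boundaryMatrix G)ᴴ *ᵥ g)) - (boundaryMatrix G)ᴴ *ᵥ g := by
  have hd' : (d : ℂ) ≠ 0 := by exact_mod_cast hd.ne'
  have hP : boundaryMatrix G *ᵥ (shiftMatrix G *ᵥ ((boundaryMatrix G)ᴴ *ᵥ g)) = μ • g := by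
    rw [Matrix.mulVec_mulVec, Matrix.mulVec_mulVec,
      boundaryMatrix_mul_shiftMatrix_mul_conjTranspose hG, Matrix.smul_mulVec, hg, smul_smul,
      inv_mul_cancel_left₀ hd']
  rw [evolutionMatrix, ← Matrix.mulVec_mulVec, coinMatrix, Matrix.sub_mulVec, Matrix.one_mulVec,
    Matrix.smul_mulVec, ← Matrix.mulVec_mulVec _ (boundaryMatrix G)ᴴ, hP, Matrix.mulVec_sub,
    Matrix.mulVec_smul, Matrix.mulVec_smul, Matrix.mulVec_smul, smul_smul]
  congr 1
  rw [Matrix.mulVec_mulVec, shiftMatrix_mul_self, Matrix.one_mulVec]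

end GroverWalk

/-! ### Necessity and the two families of examples. -/

namespace generalizedJohnson

open GroverWalk

variable {n k i : ℕ}

theorem eq_of_hasPST (hn : 2 * k ≤ n) (hik : i < k) (h : HasPST (generalizedJohnson n k i)) :
    n = 2 * k ∧ (i = 0 ∨ k = 2 ∧ i = 1) := by
  obtain ⟨τ, u, v, hp⟩ := h
  have hreg := isRegularOfDegree (n := n) hik
  have hd := degree_pos hn hik
  have hτ : τ ≠ 0 := hp.2.1.ne'
  have huv : u.1 ≠ v.1 := fun h => hp.1 (Subtype.ext h)
  have h1 := fun a => hp.chebyshev_eval_mul_eq hd hreg (sum_sgn_add_const hn hik a)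
  set T := (Polynomial.Chebyshev.T ℝ τ).eval ((i : ℝ) / k - (k - i) / (n - k)) with hT
  have hn0 : (n : ℝ) ≠ 0 := by
    have : n ≠ 0 := by omega
    exact_mod_cast this
  obtain ⟨a, hau, hav⟩ : ∃ a ∈ u.1, a ∉ v.1 := by
    by_contra! hsub
    exact huv (Finset.eq_of_subset_of_card_le hsub (by rw [u.2, v.2]))
  obtain ⟨b, hbv, hbu⟩ : ∃ b ∈ v.1, b ∉ u.1 := by
    by_contra! hsub
    exact huv (Finset.eq_of_subset_of_card_le hsub (by rw [u.2, v.2])).symm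
  have ha := h1 a
  have hb := h1 b
  rw [sgn_of_mem hau, sgn_of_notMem hav] at ha
  rw [sgn_of_notMem hbu, sgn_of_mem hbv] at hb
  -- The equations read `T (1 + c) = c - 1` and `T (c - 1) = c + 1`; eliminating `T` gives `(c - 1)²
  -- = (c + 1)²`.
  have hc : ((n : ℝ) - 2 * k) / n = 0 := by
    generalize ((n : ℝ) - 2 * k) / n = c at ha hb
    linear_combination (1 / 4 : ℝ) * (c - 1) * ha - (1 / 4 : ℝ) * (1 + c) * hb
  have hnk : n = 2 * k := by
    have := (div_eq_zero_iff.1 hc).resolve_right hn0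
    have : (n : ℝ) = 2 * k := by linarith
    exact_mod_cast this
  refine ⟨hnk, ?_⟩
  have hT1 : T = -1 := by
    rw [hc] at ha
    linarith
  simp only [hT1, hc, add_zero] at h1
  subst hnk
  -- Now `sgn x v = -sgn x u` for every point `x`, so `v` is the complement of `u`.
  by_contra! hcon
  obtain ⟨hi0, hk2⟩ := hcon
  have hkr : (2 : ℝ) ≤ k := by
    have : 2 ≤ k := by omega
    exact_mod_cast this
  have hikr : (i : ℝ) < k := by exact_mod_cast hik
  have hir : (0 : ℝ) < i := by
    have : 0 < i := by omega
    exact_mod_cast this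
  have hk0 : (k : ℝ) ≠ 0 := by linarith
  have hμ : (i : ℝ) / k - (k - i) / (((2 * k : ℕ) : ℝ) - k) = (2 * i - k) / k := by
    rw [show ((2 * k : ℕ) : ℝ) - k = k by push_cast; ring]
    field_simp
    ring
  rw [hμ] at hT
  have hr := mem_of_abs_chebyshev_eval_eq_one hτ (μ := (2 * i - k) / k)
    ⟨(2 * i - k) / k, by push_cast; ring⟩ (show |_| = (1 : ℝ) by rw [← hT, hT1]; norm_num)
  -- Both signs flip from `u` to `v`, so the product is unchanged and the second eigenvalue gets
  -- Chebyshev value `1`.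
  obtain ⟨x, hx, y, hy, hxy⟩ := Finset.one_lt_card.1 (show 1 < u.1.card by rw [u.2]; omega)
  have h2 := hp.chebyshev_eval_mul_eq hd hreg
    (sum_sgn_mul_sgn_add_const (by omega) hik hxy)
  have hv : sgn x v * sgn y v = 1 := by
    rw [← h1 x, ← h1 y, sgn_of_mem hx, sgn_of_mem hy]
    norm_num
  rw [hv, sgn_of_mem hx, sgn_of_mem hy, one_mul] at h2
  have hpos : (0 : ℝ) < 1 + 1 / (2 * k - 1) := by
    have : (0 : ℝ) < 2 * k - 1 := by linarith
    positivity
  have h3 := mul_eq_right₀ hpos.ne' |>.1 h2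
  have hs := mem_of_abs_chebyshev_eval_eq_one hτ
    (μ := ((2 * k - 1) * ((2 * i - k) / k) ^ 2 - 1) / (2 * (k - 1)))
    ⟨((2 * k - 1) * ((2 * i - k) / k) ^ 2 - 1) / (2 * (k - 1)), by push_cast; ring⟩
    (show |_| = (1 : ℝ) by rw [h3]; norm_num)
  have hden : (2 * ((k : ℝ) - 1)) ≠ 0 := by linarith
  simp only [Set.mem_insert_iff, Set.mem_singleton_iff, div_eq_iff hden] at hs
  -- The values `±1` would mean `i = k` or `i = 0`.
  have hsq : ((2 * (i : ℝ) - k) / k) ^ 2 = 1 / 4 ∨ ((2 * (i : ℝ) - k) / k) = 0 := by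
    rcases hr with hr | hr | hr | hr | hr
    · rw [div_eq_iff hk0] at hr
      linarith
    · left; rw [hr]; norm_num
    · exact Or.inr hr
    · left; rw [hr]; norm_num
    · rw [Set.mem_singleton_iff, div_eq_iff hk0] at hr
      linarith
  rcases hsq with hsq | hr0
  · rw [hsq] at hs
    -- Each possible value of the second eigenvalue gives a linear equation in `k` with no integer
    -- solution `k ≥ 2`.
    have : (10 * (k : ℝ) = 13) ∨ (2 * (k : ℝ) = 3) ∨ (2 * (k : ℝ) = 5) ∨ (k : ℝ) < 1 := by
      rcases hs with hs | hs | hs | hs | hs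
      · left; linarith
      · right; left; linarith
      · right; right; left; linarith
      · right; right; right; linarith
      · right; right; right; linarith
    norm_cast at this
    omega
  · rw [hr0] at hs
    have hki : 2 * (i : ℝ) = k := by
      rw [div_eq_iff hk0] at hr0
      linarith
    -- Only the second eigenvalue `-1/2` is feasible: it gives `k = 2`, hence `i = 1`.
    have : (2 * (k : ℝ) = 3) ∨ (k : ℝ) = 2 ∨ (k : ℝ) < 1 := by
      rcases hs with hs | hs | hs | hs | hs
      · left; linarith
      · right; left; linarith
      · linarith
      · right; right; linarith
      · right; right; linarith
    norm_cast at this hki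
    omega

/-- `J(2k, k, 0)` is a perfect matching, in which the walk swaps complementary subsets. -/
theorem hasPST_compl (hk : 0 < k) : HasPST (generalizedJohnson (2 * k) k 0) := by
  have hreg := isRegularOfDegree (n := 2 * k) hk
  have hpos : ∀ E, 0 < (generalizedJohnson (2 * k) k 0).degree E := fun E => by
    rw [hreg.degree_eq]; exact degree_pos le_rfl hk
  have hcompl : ∀ E : {E : Finset (Fin (2 * k)) // E.card = k}, (E.1ᶜ).card = k := fun E => by
    rw [Finset.card_compl, E.2, Fintype.card_fin]; omega
  -- A `k`-set disjoint from `E` fills the complement, which also has `k` elements.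
  have hadj : ∀ {E F}, (generalizedJohnson (2 * k) k 0).Adj E F → F.1 = E.1ᶜ := by
    intro E F h
    refine Finset.eq_of_subset_of_card_le (fun x hx => ?_) (by rw [hcompl, F.2])
    rw [Finset.mem_compl]
    intro hxE
    have := Finset.card_eq_zero.1 h.2
    exact Finset.notMem_empty x (this ▸ Finset.mem_inter.2 ⟨hxE, hx⟩)
  obtain ⟨E, hE⟩ := Finset.exists_subset_card_eq (s := (Finset.univ : Finset (Fin (2 * k))))
    (n := k) (by simp; omega)
  refine ⟨1, ⟨E, hE.2⟩, ⟨Eᶜ, hcompl ⟨E, hE.2⟩⟩, ?_, one_pos, 1, norm_one, ?_⟩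
  · intro h
    obtain ⟨x, hx⟩ := Finset.card_pos.1 (hE.2.symm ▸ hk)
    have h' : E = Eᶜ := congrArg Subtype.val h
    exact Finset.mem_compl.1 (h' ▸ hx) hx
  · rw [pow_one, one_smul, vertexState, evolutionMatrix_mulVec_conjTranspose_mulVec hpos]
    ext a
    rw [shiftMatrix_mulVec_apply, vertexState, conjTranspose_boundaryMatrix_mulVec_apply,
      conjTranspose_boundaryMatrix_mulVec_apply, hreg.degree_eq, hreg.degree_eq]
    congr 1
    have h := hadj a.adj
    simp only [SimpleGraph.Dart.symm_toProd, Prod.snd_swap, Pi.single_apply, Subtype.ext_iff, h,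
      compl_inj_iff]

/-- `J(4, 2, 1)` is the octahedron, in which the walk swaps antipodes at time `6`. -/
theorem hasPSTAt_four_two_one : HasPSTAt (generalizedJohnson 4 2 1) 6 := by
  set G := generalizedJohnson 4 2 1 with hGdef
  have hreg : G.IsRegularOfDegree 4 := isRegularOfDegree (n := 4) (k := 2) (i := 1) (by norm_num)
  have hpos : ∀ E, 0 < G.degree E := fun E => by rw [hreg.degree_eq]; norm_num
  let u : {E : Finset (Fin 4) // E.card = 2} := ⟨{0, 1}, rfl⟩
  let v : {E : Finset (Fin 4) // E.card = 2} := ⟨{2, 3}, rfl⟩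
  have huv : u ≠ v := by decide
  -- `u` and `v` are antipodes: all four other vertices are adjacent to both.
  have hadj : ∀ w, (w = u ∨ w = v) ∧ ¬ G.Adj w u ∧ ¬ G.Adj w v ∨
      w ≠ u ∧ w ≠ v ∧ G.Adj w u ∧ G.Adj w v := by decide
  let X : ({E : Finset (Fin 4) // E.card = 2} → ℂ) → G.Dart → ℂ :=
    fun g => (boundaryMatrix G)ᴴ *ᵥ g
  let Y : ({E : Finset (Fin 4) // E.card = 2} → ℂ) → G.Dart → ℂ :=
    fun g => shiftMatrix G *ᵥ X g
  have hUX : ∀ g, evolutionMatrix G *ᵥ X g = Y g :=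
    evolutionMatrix_mulVec_conjTranspose_mulVec hpos
  have hUY : ∀ (g : {E : Finset (Fin 4) // E.card = 2} → ℂ) (μ : ℂ),
      G.adjMatrix ℂ *ᵥ g = ((4 : ℕ) * μ) • g →
      evolutionMatrix G *ᵥ Y g = (2 * μ) • Y g - X g := fun g μ hg =>
    evolutionMatrix_mulVec_shiftMatrix_mulVec (by norm_num) hreg hg
  have hU6 : ∀ x, evolutionMatrix G ^ 6 *ᵥ x = evolutionMatrix G *ᵥ (evolutionMatrix G *ᵥ
      (evolutionMatrix G *ᵥ (evolutionMatrix G *ᵥ (evolutionMatrix G *ᵥ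
        (evolutionMatrix G *ᵥ x))))) := fun x => by
    simp only [Matrix.mulVec_mulVec]
    congr 1
    simp only [pow_succ, pow_zero, one_mul, mul_assoc]
  -- Eigenvectors of `A / 4` for `1`, `0` and `-1/2`; their span contains the unit vectors at `u`
  -- and `v`.
  let g0 : {E : Finset (Fin 4) // E.card = 2} → ℂ := fun _ => 1
  let g1 : {E : Finset (Fin 4) // E.card = 2} → ℂ := Pi.single u 1 - Pi.single v 1
  let g2 : {E : Finset (Fin 4) // E.card = 2} → ℂ :=
    (3 : ℂ) • (Pi.single u 1 + Pi.single v 1) - g0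
  have hY0 : Y g0 = X g0 := by
    ext a
    simp only [Y, X, g0, shiftMatrix_mulVec_apply, conjTranspose_boundaryMatrix_mulVec_apply,
      hreg.degree_eq]
  have hA1 : G.adjMatrix ℂ *ᵥ g1 = ((4 : ℕ) * (0 : ℂ)) • g1 := by
    ext w
    have := hadj w
    rw [Matrix.mulVec_sub, Matrix.mulVec_single_one, Matrix.mulVec_single_one]
    simp only [Pi.sub_apply, Matrix.col_apply, SimpleGraph.adjMatrix_apply]
    rcases this with ⟨-, h1, h2⟩ | ⟨-, -, h1, h2⟩ <;> simp [h1, h2]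
  have hA2 : G.adjMatrix ℂ *ᵥ g2 = ((4 : ℕ) * (-1 / 2 : ℂ)) • g2 := by
    ext w
    have := hadj w
    rw [Matrix.mulVec_sub, Matrix.mulVec_smul, Matrix.mulVec_add, Matrix.mulVec_single_one,
      Matrix.mulVec_single_one]
    have h0 : (G.adjMatrix ℂ *ᵥ g0) w = 4 := by
      rw [SimpleGraph.adjMatrix_mulVec_apply]
      simp [g0, hreg.degree_eq]
    simp only [Pi.sub_apply, Pi.smul_apply, Pi.add_apply, Matrix.col_apply,
      SimpleGraph.adjMatrix_apply, h0, g2, g0, smul_eq_mul, Pi.single_apply]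
    rcases this with ⟨h | h, h1, h2⟩ | ⟨h, h', h1, h2⟩
    · rw [if_neg h1, if_neg h2, if_pos h, if_neg (fun h' => huv (h.symm.trans h'))]; norm_num
    · rw [if_neg h1, if_neg h2, if_pos h, if_neg (fun h' => huv (h'.symm.trans h))]; norm_num
    · rw [if_pos h1, if_pos h2, if_neg h, if_neg h']; norm_num
  have hU0 : evolutionMatrix G ^ 6 *ᵥ X g0 = X g0 := by
    simp only [hU6, hUX, hY0]
  -- Eigenvalue `0` is a quarter turn: `U² = -1` on `X g1`, hence `U⁶ = -1`.
  have hU1 : evolutionMatrix G ^ 6 *ᵥ X g1 = -X g1 := by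
    simp only [hU6, hUX, hUY g1 0 hA1, mul_zero, zero_smul, zero_sub, Matrix.mulVec_neg, neg_neg]
  have hU2 : evolutionMatrix G ^ 6 *ᵥ X g2 = X g2 := by
    -- Eigenvalue `-1/2 = cos (2π/3)` is a third of a turn, so `U³` fixes `X g2`.
    have h : evolutionMatrix G *ᵥ (evolutionMatrix G *ᵥ (evolutionMatrix G *ᵥ X g2)) = X g2 := by
      rw [hUX, hUY g2 _ hA2, Matrix.mulVec_sub, Matrix.mulVec_smul, hUX, hUY g2 _ hA2]
      ext a
      simp only [Pi.sub_apply, Pi.smul_apply, smul_eq_mul]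
      ring
    rw [hU6, h, h]
  refine ⟨u, v, huv, by norm_num, 1, norm_one, ?_⟩
  -- Passing from `u` to `v` changes only the sign of the `g1` component, exactly as `U⁶` does.
  have hu : vertexState G u = X ((1 / 6 : ℂ) • g0 + (1 / 2 : ℂ) • g1 + (1 / 6 : ℂ) • g2) := by
    simp only [vertexState, X]
    congr 1
    ext w
    simp only [g0, g1, g2, Pi.add_apply, Pi.sub_apply, Pi.smul_apply, smul_eq_mul]
    ring
  have hv : vertexState G v = X ((1 / 6 : ℂ) • g0 - (1 / 2 : ℂ) • g1 + (1 / 6 : ℂ) • g2) := by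
    simp only [vertexState, X]
    congr 1
    ext w
    simp only [g0, g1, g2, Pi.add_apply, Pi.sub_apply, Pi.smul_apply, smul_eq_mul]
    ring
  rw [one_smul, hu, hv]
  simp only [X, Matrix.mulVec_add, Matrix.mulVec_sub, Matrix.mulVec_smul] at hU0 hU1 hU2 ⊢
  rw [hU0, hU1, hU2, smul_neg, sub_eq_add_neg]

end generalizedJohnson

theorem theorem3p15 :
    (∀ n k i : ℕ, 0 < k → 2 * k ≤ n → i < k →
      (GroverWalk.HasPST (generalizedJohnson n k i) ↔
        (n, k, i) = (2 * k, k, 0) ∨ (n, k, i) = (4, 2, 1))) ∧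
    GroverWalk.HasPSTAt (generalizedJohnson 4 2 1) 6 := by
  refine ⟨fun n k i hk hn hik => ⟨fun h => ?_, ?_⟩, generalizedJohnson.hasPSTAt_four_two_one⟩
  · obtain ⟨rfl, rfl | ⟨rfl, rfl⟩⟩ := generalizedJohnson.eq_of_hasPST hn hik h
    · exact Or.inl rfl
    · exact Or.inr rfl
  · rintro (h | h)
    · obtain ⟨rfl, -, rfl⟩ : n = 2 * k ∧ k = k ∧ i = 0 := by simpa using h
      exact generalizedJohnson.hasPST_compl hk
    · obtain ⟨rfl, rfl, rfl⟩ : n = 4 ∧ k = 2 ∧ i = 1 := by simpa using h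
      exact ⟨6, generalizedJohnson.hasPSTAt_four_two_one⟩
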